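/- Let $T\subset\mathbb R^d$ be a non-degenerate (closed) simplex with vertices $v_0,\dots,v_d$ that is completely well-centered: $T$ and every face of $T$, of any dimension, contain their circumcenters. Let $c$ and $R$ be the circumcenter and circumradius of $T$, let $U=\frac12(c+T)$ be the simplex with vertices $\frac12(c+v_i)$, let $b_0,\dots,b_d$ be the barycentric coordinates relative to $U$, and for $x\in\mathbb R^d$ let $\varphi(x)$ be the point of $U$ closest to $x$. Let $W^2(T)$ be the class of all $f\in C^1(T)$ such that for all distinct $x,y\in T$ the function $g(t)=f\big(x+\frac t\rho(y-x)\big)$, $t\in[0,\rho]$, $\rho=|y-x|$, has an absolutely continuous derivative $g'$ on $[0,\rho]$ with $|g''|\le 1$ almost everywhere. For $f\in C^1(T)$ put $I(f)=(f(v_0),\dots,f(v_d),\nabla f(v_0),\dots,\nabla f(v_d))\in\mathbb R^{(d+1)^2}$ and $$p_f(w)=\sum_{i=0}^d b_i(\varphi(w))\Big(f(v_i)+\nabla f(v_i)\cdot\big(w-\varphi(w)+\tfrac12(c-v_i)\big)\Big),$$ $$\mathcal E(w)=\frac{R^2}4+|w-\varphi(w)|^2-\frac12|w-c|^2 .$$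 Thus $p_f(w)$ depends on $f$ only through $I(f)$. (i) For every $w\in T$, the method $f\mapsto p_f(w)$ is optimal for the recovery of $f(w)$ on $W^2(T)$ from $I(f)$, with error $\mathcal E(w)$; that is, $$\sup_{f\in W^2(T)}|f(w)-p_f(w)|=\inf_{\Psi:\mathbb R^{(d+1)^2}\to\mathbb R}\ \sup_{f\in W^2(T)}|f(w)-\Psi(I(f))|=\mathcal E(w).$$ (ii) The function $\mathcal E$ and, for all data, the function $p_f$ are continuous on $T$, and for every monotone seminorm $\|\cdot\|$ on $C(T)$ (a seminorm such that $\|f_1\|\le\|f_2\|$ whenever $|f_1|\le|f_2|$ on $T$) the method $f\mapsto p_f$ is optimal for global recovery on $W^2(T)$, with error $\|\mathcal E\|$; that is, $$\sup_{f\in W^2(T)}\|f-p_f\|=\inf_{\Phi:\mathbb R^{(d+1)^2}\to C(T)}\ \sup_{f\in W^2(T)}\|f-\Phi(I(f))\|=\|\mathcal E\|.$$ -/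

import Mathlib

noncomputable section

open MeasureTheory Set

namespace SimplexRecovery

/-- The space `ℝ^d` with its Euclidean norm and dot product. -/
abbrev Space (d : ℕ) : Type := EuclideanSpace ℝ (Fin d)

/-- A non-degenerate simplex in `ℝ^d`: its `d + 1` vertices `T.points 0, …, T.points d` are affinely
independent. As a set of points the (closed) simplex is `T.closedInterior`. -/
abbrev FullSimplex (d : ℕ) : Type := Affine.Simplex ℝ (Space d) d

/-! ### Function classes -/

/-- `W²_∞[a,b]`: the functions `g` that have a derivative everywhere on `[a,b]` (one-sided at the end
points), such that `g'` is absolutely continuous on `[a,b]` and `|g''| ≤ 1` almost everywhere. -/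
def IntervalW2 (a b : ℝ) (g : ℝ → ℝ) : Prop :=
  DifferentiableOn ℝ g (Icc a b) ∧
    AbsolutelyContinuousOnInterval (derivWithin g (Icc a b)) a b ∧
    ∀ᵐ t ∂(volume : Measure ℝ), t ∈ Icc a b → |deriv (derivWithin g (Icc a b)) t| ≤ 1

/-- `C¹(P)`. Functions on `P` are given by functions on `ℝ^d` whose values off `P` are irrelevant. -/
def C1 {d : ℕ} (P : Set (Space d)) : Set (Space d → ℝ) :=
  {f | ContDiffOn ℝ 1 f P}

/-- `W²(P)`: the functions in `C¹(P)` whose restriction to every non-trivial segment contained in `P`,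
parametrized by arc length, is in `W²_∞`. -/
def W2 {d : ℕ} (P : Set (Space d)) : Set (Space d → ℝ) :=
  {f | f ∈ C1 P ∧ ∀ x ∈ P, ∀ y ∈ P, x ≠ y →
    IntervalW2 0 ‖y - x‖ (fun t => f (x + (t / ‖y - x‖) • (y - x)))}

theorem W2_subset_C1 {d : ℕ} (P : Set (Space d)) : W2 P ⊆ C1 P := fun _ hf => hf.1

/-- The restriction to `P` of a function in `C¹(P)`, as an element of `C(P)`. -/
def restrictC {d : ℕ} {P : Set (Space d)} {f : Space d → ℝ} (hf : f ∈ C1 P) : C(P, ℝ) :=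
  ⟨P.domRestrict f, (ContDiffOn.continuousOn hf).domRestrict⟩

/-! ### The optimal recovery problems -/

/-- The data space: `d + 1` function values and `d + 1` gradients, that is `ℝ^((d+1)^2)`. -/
abbrev Data (d : ℕ) : Type := (Fin (d + 1) → ℝ) × (Fin (d + 1) → Space d)

/-- The information vector `I(f)` of a function `f` on `P`: the values and the gradients (relative to
the domain `P`) of `f` at the vertices of `T`. -/
def info {d : ℕ} (T : FullSimplex d) (P : Set (Space d)) (f : Space d → ℝ) : Data d :=
  (fun i => f (T.points i), fun i => gradientWithin f P (T.points i))

/-- The worst-case error `sup_{f ∈ F} |f(w) - Ψ(I(f))|` of the algorithm `Ψ` at the point `w`,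
a supremum in the extended reals. -/
def pointError {d : ℕ} (T : FullSimplex d) (P : Set (Space d)) (F : Set (Space d → ℝ))
    (w : Space d) (Ψ : Data d → ℝ) : EReal :=
  ⨆ f ∈ F, ((|f w - Ψ (info T P f)| : ℝ) : EReal)

/-- The optimal error `e_w(F)` of recovery of `f(w)`: the infimum over all algorithms. -/
def optimalPointError {d : ℕ} (T : FullSimplex d) (P : Set (Space d)) (F : Set (Space d → ℝ))
    (w : Space d) : EReal :=
  ⨅ Ψ : Data d → ℝ, pointError T P F w Ψ

/-- `Ψ` is an optimal algorithm for the recovery of `f(w)` on `F`: it attains the infimum. -/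
def IsOptimalAt {d : ℕ} (T : FullSimplex d) (P : Set (Space d)) (F : Set (Space d → ℝ))
    (w : Space d) (Ψ : Data d → ℝ) : Prop :=
  pointError T P F w Ψ = optimalPointError T P F w

/-- A monotone seminorm on `C(P)`. -/
def IsMonotone {d : ℕ} {P : Set (Space d)} (N : Seminorm ℝ C(P, ℝ)) : Prop :=
  ∀ f g : C(P, ℝ), (∀ x, |f x| ≤ |g x|) → N f ≤ N g

/-- The worst-case error `sup_{f ∈ F} ‖f - Φ(I(f))‖` of the global algorithm `Φ`. -/
def globalError {d : ℕ} (T : FullSimplex d) {P : Set (Space d)} {F : Set (Space d → ℝ)}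
    (hF : F ⊆ C1 P) (N : Seminorm ℝ C(P, ℝ)) (Φ : Data d → C(P, ℝ)) : EReal :=
  ⨆ f : F, ((N (restrictC (hF f.2) - Φ (info T P f)) : ℝ) : EReal)

/-- The optimal error `R(F; ‖·‖)` of global recovery: the infimum over all algorithms. -/
def optimalGlobalError {d : ℕ} (T : FullSimplex d) {P : Set (Space d)} {F : Set (Space d → ℝ)}
    (hF : F ⊆ C1 P) (N : Seminorm ℝ C(P, ℝ)) : EReal :=
  ⨅ Φ : Data d → C(P, ℝ), globalError T hF N Φ

/-- `Φ` is an optimal algorithm for global recovery on `F`: it attains the infimum. -/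
def IsGloballyOptimal {d : ℕ} (T : FullSimplex d) {P : Set (Space d)} {F : Set (Space d → ℝ)}
    (hF : F ⊆ C1 P) (N : Seminorm ℝ C(P, ℝ)) (Φ : Data d → C(P, ℝ)) : Prop :=
  globalError T hF N Φ = optimalGlobalError T hF N

/-- `Φ` is pointwise optimal on `F`: its restriction to any `w ∈ P` is optimal for recovery of
`f(w)`. -/
def IsPointwiseOptimal {d : ℕ} (T : FullSimplex d) {P : Set (Space d)} (F : Set (Space d → ℝ))
    (Φ : Data d → C(P, ℝ)) : Prop :=
  ∀ w : P, IsOptimalAt T P F w (fun y => Φ y w)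

/-! ### Geometry of the simplex -/

/-- `T` and all its faces, of any dimension, contain their circumcenters. -/
def CompletelyWellCentered {d : ℕ} (T : FullSimplex d) : Prop :=
  ∀ (m : ℕ) (s : Finset (Fin (d + 1))) (h : s.card = m + 1),
    (T.face h).circumcenter ∈ (T.face h).closedInterior

theorem homothety_half_injective {d : ℕ} (c : Space d) :
    Function.Injective (AffineMap.homothety c (1 / 2 : ℝ)) := by
  intro x y h
  simpa [AffineMap.homothety_apply] using h

/-- The simplex `U = (c + T) / 2`, where `c` is the circumcenter of `T`; the homothety with center `c`
and ratio `1/2` is `x ↦ (c + x) / 2`. -/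
def halfSimplex {d : ℕ} (T : FullSimplex d) : FullSimplex d :=
  T.map (AffineMap.homothety T.circumcenter (1 / 2 : ℝ)) (homothety_half_injective _)

theorem halfSimplex_points {d : ℕ} (T : FullSimplex d) (i : Fin (d + 1)) :
    (halfSimplex T).points i = (1 / 2 : ℝ) • (T.circumcenter + T.points i) := by
  simp only [halfSimplex, Affine.Simplex.map_points, Function.comp, AffineMap.homothety_apply,
    vsub_eq_sub, vadd_eq_add]
  module

/-- The vertices of a non-degenerate simplex as an affine basis of `ℝ^d`. -/
def vertexBasis {d : ℕ} (S : FullSimplex d) : AffineBasis (Fin (d + 1)) ℝ (Space d) where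
  toFun := S.points
  ind' := S.independent
  tot' := S.span_eq_top (by simp)

/-- The barycentric coordinates `b_i(x)` relative to the simplex `U = (c + T) / 2`. -/
def bary {d : ℕ} (T : FullSimplex d) (i : Fin (d + 1)) (x : Space d) : ℝ :=
  (vertexBasis (halfSimplex T)).coord i x

theorem exists_closest {d : ℕ} (T : FullSimplex d) (x : Space d) :
    ∃ y ∈ (halfSimplex T).closedInterior,
      ∀ z ∈ (halfSimplex T).closedInterior, dist x y ≤ dist x z := by
  obtain ⟨y, hy, h⟩ := (halfSimplex T).isCompact_closedInterior.exists_isMinOn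
    ⟨_, (halfSimplex T).point_mem_closedInterior 0⟩
    (continuous_const.dist continuous_id : Continuous fun z => dist x z).continuousOn
  exact ⟨y, hy, fun z hz => h hz⟩

/-- `φ(x)`: the (unique) point of `U` closest to `x`. -/
def nearest {d : ℕ} (T : FullSimplex d) (x : Space d) : Space d :=
  (exists_closest T x).choose

theorem nearest_spec {d : ℕ} (T : FullSimplex d) (x : Space d) :
    nearest T x ∈ (halfSimplex T).closedInterior ∧
      ∀ z ∈ (halfSimplex T).closedInterior, dist x (nearest T x) ≤ dist x z :=
  (exists_closest T x).choose_spec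

/-- The recovery method as a function of the data `y`: with `y = I(f)` this is
`p_f(w) = ∑ i, b_i(φ(w)) (f(v_i) + ∇f(v_i) ⬝ (w - φ(w) + (c - v_i) / 2))`. -/
def recovery {d : ℕ} (T : FullSimplex d) (y : Data d) (w : Space d) : ℝ :=
  ∑ i, bary T i (nearest T w) *
    (y.1 i + inner ℝ (y.2 i)
      (w - nearest T w + (1 / 2 : ℝ) • (T.circumcenter - T.points i)))

/-- The error function `𝓔(w) = R²/4 + |w - φ(w)|² - |w - c|²/2`. -/
def errorFun {d : ℕ} (T : FullSimplex d) (w : Space d) : ℝ :=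
  T.circumradius ^ 2 / 4 + ‖w - nearest T w‖ ^ 2 - ‖w - T.circumcenter‖ ^ 2 / 2

end SimplexRecovery

end

/-! Write `y = φ(w)`, let `u_i` be the vertices of `U`, and set `z_i = u_i + (w - y)`. For the upper
bound, expand `f(z_i)` by Taylor's formula both at `v_i` and at `w`. Averaged with the weights
`b_i(y)`, the points `z_i` give `w`, so the unknown gradient at `w` cancels; what remains is `f(w) -
p_f(w)`, bounded by the average of `(|z_i - v_i|² + |z_i - w|²)/2`. This average is exactly `𝓔(w)`,
because `|u_i - c| = R/2`.

The expansions require `z_i ∈ T` whenever `b_i(y) ≠ 0` (`translate_mem`). Since `z_i` is the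
midpoint of `v_i` and `c + 2(w - y)`, it suffices that the latter point is in `T`. It lies in the
Voronoi cell of the face spanned by the vertices with `b_k(y) ≠ 0`, and complete well-centeredness
then places it in `T` (`mem_convexHull_of_voronoi`).

For the lower bound, `𝓔` and `-𝓔` belong to `W²(T)` and have zero data, so no method can tell them
apart. Their gradients are `1`-Lipschitz because the metric projection is firmly nonexpansive. This
half holds for every non-degenerate simplex. -/

noncomputable section

open MeasureTheory Set

namespace SimplexRecovery

/-! ### Voronoi cells and well-centered faces -/

section Voronoi

variable {ι E : Type*} [Fintype ι] [DecidableEq ι] [NormedAddCommGroup E] [InnerProductSpace ℝ E]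

/-- If every face of a simplex contains its circumcenter, then a point of the Voronoi cell of the face
`J` lies in the simplex as soon as its weights off `J` are nonnegative. -/
theorem mem_convexHull_of_voronoi (v : ι → E) (c : E)
    (hface : ∀ J : Finset ι, J.Nonempty → ∃ ν : ι → ℝ, (∀ i, 0 ≤ ν i) ∧ (∀ i ∉ J, ν i = 0) ∧
      ∑ i, ν i = 1 ∧ ∀ i ∈ J, ∀ j ∈ J, inner ℝ (∑ k, ν k • v k - c) (v i - v j) = 0)
    (J : Finset ι) (hJ : J.Nonempty) (μ : ι → ℝ) (hμ : ∑ i, μ i = 1) (hoff : ∀ i ∉ J, 0 ≤ μ i)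
    (hcell : ∀ j ∈ J, ∀ l, inner ℝ (∑ k, μ k • v k - c) (v l - v j) ≤ 0) :
    ∑ k, μ k • v k ∈ convexHull ℝ (range v) := by
  induction hn : Jᶜ.card using Nat.strong_induction_on generalizing J μ with
  | _ n ih =>
  obtain ⟨ν, hν0, hνJ, hν1, hνc⟩ := hface J hJ
  obtain ⟨j, hj⟩ := hJ
  set x := ∑ k, μ k • v k with hx
  set p := ∑ k, ν k • v k with hp
  have hpmem : p ∈ convexHull ℝ (range v) :=
    (convex_convexHull ℝ _).sum_mem (fun i _ => hν0 i) hν1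
      (fun i _ => subset_convexHull ℝ _ (mem_range_self i))
  set e := x - p with he
  have hcellJ : ∀ i ∈ J, inner ℝ (x - c) (v i - v j) = 0 := fun i hi => by
    have h1 := hcell j hj i
    have h2 := hcell i hi j
    rw [← neg_sub (v i), inner_neg_right] at h2
    linarith
  have heJ : ∀ i ∈ J, inner ℝ e (v i - v j) = 0 := fun i hi => by
    have : e = (x - c) - (p - c) := by rw [he]; abel
    rw [this, inner_sub_left, hcellJ i hi, hνc i hi j hj, sub_zero]
  by_cases hall : ∀ l, inner ℝ e (v l - v j) ≤ 0
  -- No vertex lies beyond the face in direction `e`: the expansion forces `|e|² ≤ 0`, so `x` is the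
  -- center `p` itself.
  · have hexp : inner ℝ e e = ∑ i, (μ i - ν i) * inner ℝ e (v i - v j) := by
      have h1 : e = ∑ i, (μ i - ν i) • (v i - v j) := by
        simp only [sub_smul, smul_sub, Finset.sum_sub_distrib, ← Finset.sum_smul, hμ, hν1]
        rw [he, hx, hp]; abel
      conv_lhs => rw [h1]
      rw [sum_inner]
      rw [← h1]
      simp only [real_inner_smul_left]
      exact Finset.sum_congr rfl fun i _ => by rw [real_inner_comm]
    have hle : inner ℝ e e ≤ 0 := by
      rw [hexp]
      refine Finset.sum_nonpos fun i _ => ?_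
      by_cases hi : i ∈ J
      · rw [heJ i hi, mul_zero]
      · rw [hνJ i hi, sub_zero]
        exact mul_nonpos_of_nonneg_of_nonpos (hoff i hi) (hall i)
    have he0 : e = 0 := real_inner_self_nonpos.1 hle
    rw [sub_eq_zero.1 he0]
    exact hpmem
  · push Not at hall
    -- Push `x` away from `p` along `e` until the first new cell constraint becomes an equality. The
    -- minimal ratio `r` is the exit time, and `l` is the vertex that joins `J`. As `ν` vanishes off
    -- `J`, the weights off `J` only grow.
    obtain ⟨l, hl, hmin⟩ := Finset.exists_min_image
      (Finset.univ.filter fun l => 0 < inner ℝ e (v l - v j))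
      (fun l => -inner ℝ (x - c) (v l - v j) / inner ℝ e (v l - v j))
      (by obtain ⟨l, hl⟩ := hall; exact ⟨l, by simpa using hl⟩)
    simp only [Finset.mem_filter, Finset.mem_univ, true_and] at hl hmin
    set r := -inner ℝ (x - c) (v l - v j) / inner ℝ e (v l - v j) with hr
    have hr0 : 0 ≤ r := div_nonneg (by linarith [hcell j hj l]) hl.le
    have hlJ : l ∉ J := fun h => by rw [heJ l h] at hl; exact lt_irrefl _ hl
    have hx' : ∑ k, (μ k + r * (μ k - ν k)) • v k = x + r • e := by
      simp only [add_smul, mul_smul, sub_smul, Finset.sum_add_distrib, ← Finset.smul_sum,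
        Finset.sum_sub_distrib]
      rfl
    have hq : ∀ m, inner ℝ (x + r • e - c) (v m - v j) =
        inner ℝ (x - c) (v m - v j) + r * inner ℝ e (v m - v j) := fun m => by
      rw [add_sub_right_comm, inner_add_left, real_inner_smul_left]
    have hq0 : ∀ i ∈ insert l J, inner ℝ (x + r • e - c) (v i - v j) = 0 := by
      intro i hi
      rw [hq]
      rcases Finset.mem_insert.1 hi with rfl | hi
      · rw [hr, div_mul_cancel₀ _ hl.ne']; ring
      · rw [hcellJ i hi, heJ i hi]; ring
    have hmem := ih (insert l J)ᶜ.card (by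
        rw [← hn]
        exact Finset.card_lt_card (Finset.compl_ssubset_compl.2 (Finset.ssubset_insert hlJ)))
      (insert l J) ⟨l, Finset.mem_insert_self _ _⟩ (fun k => μ k + r * (μ k - ν k))
      (by rw [Finset.sum_add_distrib, ← Finset.mul_sum, Finset.sum_sub_distrib, hμ, hν1]; ring)
      (fun i hi => by
        have hi' : i ∉ J := fun h => hi (Finset.mem_insert_of_mem h)
        rw [hνJ i hi', sub_zero]
        have := hoff i hi'
        positivity)
      (fun i hi m => by
        rw [hx', ← sub_sub_sub_cancel_right (v m) (v i) (v j), inner_sub_right, hq0 i hi, sub_zero,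
          hq]
        by_cases hm : 0 < inner ℝ e (v m - v j)
        · have h1 := hmin m hm
          rw [le_div_iff₀ hm] at h1
          linarith
        · have h1 := hcell j hj m
          have h2 := mul_nonpos_of_nonneg_of_nonpos hr0 (not_lt.1 hm)
          linarith)
      rfl
    rw [hx'] at hmem
    -- `x` lies on the segment from `p` to the exit point, and both ends are in the hull.
    have hcomb : x = (1 / (1 + r)) • (x + r • e) + (r / (1 + r)) • p := by
      have h1 : (1 + r) ≠ 0 := by positivity
      have h2 : (1 + r) • x = (1 + r) • ((1 / (1 + r)) • (x + r • e) + (r / (1 + r)) • p) := by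
        rw [smul_add, smul_smul, smul_smul, mul_div_cancel₀ _ h1, mul_div_cancel₀ _ h1, he]
        module
      exact smul_right_injective E h1 h2
    rw [hcomb]
    exact (convex_convexHull ℝ _) hmem hpmem (by positivity) (by positivity)
      (by rw [← add_div, div_self (by positivity)])

end Voronoi

variable {d : ℕ}

/-! ### Barycentric coordinates and circumcenters of faces -/

theorem convex_closedInterior (S : FullSimplex d) : Convex ℝ S.closedInterior := by
  rw [← Affine.Simplex.convexHull_eq_closedInterior]
  exact convex_convexHull ℝ _

theorem mem_closedInterior_iff_coord (S : FullSimplex d) (x : Space d) :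
    x ∈ S.closedInterior ↔ ∀ i, 0 ≤ (vertexBasis S).coord i x := by
  rw [← Affine.Simplex.convexHull_eq_closedInterior]
  change x ∈ convexHull ℝ (range (vertexBasis S)) ↔ _
  rw [(vertexBasis S).convexHull_eq_nonneg_coord]
  rfl

theorem sum_coord_smul_points (S : FullSimplex d) (x : Space d) :
    ∑ i, (vertexBasis S).coord i x • S.points i = x :=
  (vertexBasis S).linear_combination_coord_eq_self x

theorem sum_coord_eq_one (S : FullSimplex d) (x : Space d) :
    ∑ i, (vertexBasis S).coord i x = 1 :=
  (vertexBasis S).sum_coord_apply_eq_one x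

theorem norm_points_sub_circumcenter (T : FullSimplex d) (i : Fin (d + 1)) :
    ‖T.points i - T.circumcenter‖ = T.circumradius := by
  rw [← dist_eq_norm]
  exact T.dist_circumcenter_eq_circumradius i

theorem inner_sub_eq_zero_of_equidistant {E : Type*} [NormedAddCommGroup E] [InnerProductSpace ℝ E]
    {a b p q : E} (hp : ‖a - p‖ = ‖b - p‖) (hq : ‖a - q‖ = ‖b - q‖) :
    inner ℝ (p - q) (a - b) = 0 := by
  have hp2 : inner ℝ (a - p) (a - p) = inner ℝ (b - p) (b - p) := by
    rw [real_inner_self_eq_norm_sq, real_inner_self_eq_norm_sq, hp]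
  have hq2 : inner ℝ (a - q) (a - q) = inner ℝ (b - q) (b - q) := by
    rw [real_inner_self_eq_norm_sq, real_inner_self_eq_norm_sq, hq]
  simp only [inner_sub_left, inner_sub_right] at *
  rw [real_inner_comm a p, real_inner_comm b p] at hp2
  rw [real_inner_comm a q, real_inner_comm b q] at hq2
  rw [real_inner_comm p a, real_inner_comm p b, real_inner_comm q a, real_inner_comm q b] at *
  linarith

/-- The weights are the barycentric coordinates of the circumcenter of the face `J`, extended by
zero. This point and the circumcenter of `T` are both equidistant from the vertices in `J`, so their
difference is orthogonal to the face. -/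
theorem CompletelyWellCentered.exists_face_weights {T : FullSimplex d}
    (hT : CompletelyWellCentered T) (J : Finset (Fin (d + 1))) (hJ : J.Nonempty) :
    ∃ ν : Fin (d + 1) → ℝ, (∀ i, 0 ≤ ν i) ∧ (∀ i ∉ J, ν i = 0) ∧ ∑ i, ν i = 1 ∧
      ∀ i ∈ J, ∀ j ∈ J,
        inner ℝ (∑ k, ν k • T.points k - T.circumcenter) (T.points i - T.points j) = 0 := by
  obtain ⟨m, hm⟩ := Nat.exists_eq_succ_of_ne_zero (Finset.card_ne_zero.2 hJ)
  have hmem := hT m J hm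
  rw [← Affine.Simplex.convexHull_eq_closedInterior, Affine.Simplex.range_face_points,
    ← Finset.coe_image, Finset.convexHull_eq] at hmem
  obtain ⟨a, ha0, ha1, ha⟩ := hmem
  have hinj : Set.InjOn T.points J := T.independent.injective.injOn
  refine ⟨fun i => if i ∈ J then a (T.points i) else 0, fun i => ?_, fun i hi => if_neg hi, ?_, ?_⟩
  · dsimp only
    split_ifs with h
    exacts [ha0 _ (Finset.mem_image_of_mem _ h), le_rfl]
  · rw [Finset.sum_ite_mem, Finset.univ_inter, ← ha1, Finset.sum_image hinj]
  · have hc : ∑ k, (if k ∈ J then a (T.points k) else 0) • T.points k =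
        (T.face hm).circumcenter := by
      rw [← ha, Finset.centerMass_eq_of_sum_1 _ _ ha1, Finset.sum_image hinj]
      simp only [ite_smul, zero_smul, Finset.sum_ite_mem, Finset.univ_inter, id]
    have hdist : ∀ i ∈ J, ‖T.points i - (T.face hm).circumcenter‖ = (T.face hm).circumradius := by
      intro i hi
      have : T.points i ∈ Set.range (T.face hm).points := by
        rw [Affine.Simplex.range_face_points]; exact ⟨i, hi, rfl⟩
      obtain ⟨k, hk⟩ := this
      rw [← hk, ← dist_eq_norm]
      exact Affine.Simplex.dist_circumcenter_eq_circumradius _ k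
    intro i hi j hj
    rw [hc]
    exact inner_sub_eq_zero_of_equidistant ((hdist i hi).trans (hdist j hj).symm)
      ((norm_points_sub_circumcenter T i).trans (norm_points_sub_circumcenter T j).symm)

/-! ### The metric projection onto `U` -/

theorem inner_sub_nearest_nonpos (T : FullSimplex d) (w : Space d) {z : Space d}
    (hz : z ∈ (halfSimplex T).closedInterior) :
    inner ℝ (w - nearest T w) (z - nearest T w) ≤ 0 := by
  obtain ⟨hmem, hmin⟩ := nearest_spec T w
  refine (norm_eq_iInf_iff_real_inner_le_zero (convex_closedInterior (halfSimplex T)) hmem).1 ?_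
    z hz
  have : Nonempty (halfSimplex T).closedInterior := ⟨⟨_, hmem⟩⟩
  refine le_antisymm (le_ciInf fun z => ?_) (ciInf_le ⟨0, ?_⟩
    (⟨_, hmem⟩ : (halfSimplex T).closedInterior))
  · simpa only [dist_eq_norm] using hmin z z.2
  · rintro _ ⟨z, rfl⟩; exact norm_nonneg _

/-- The variational inequality characterizes the projection, and by convexity it need only be tested
at the vertices of `U`. Adding the inequalities for `y` and for `nearest T w` gives `|nearest T w -
y|² ≤ 0`. -/
theorem nearest_eq_of_inner_nonpos (T : FullSimplex d) {w y : Space d}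
    (hy : y ∈ (halfSimplex T).closedInterior)
    (h : ∀ i, inner ℝ (w - y) ((halfSimplex T).points i - y) ≤ 0) : nearest T w = y := by
  obtain ⟨hmem, -⟩ := nearest_spec T w
  have h1 := inner_sub_nearest_nonpos T w hy
  have h2 : inner ℝ (w - y) (nearest T w - y) ≤ 0 := by
    have hexp : nearest T w - y =
        ∑ i, bary T i (nearest T w) • ((halfSimplex T).points i - y) := by
      have hs := sum_coord_smul_points (halfSimplex T) (nearest T w)
      have h1' := sum_coord_eq_one (halfSimplex T) (nearest T w)
      simp only [bary, smul_sub, Finset.sum_sub_distrib, ← Finset.sum_smul, hs, h1', one_smul]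
    rw [hexp, inner_sum]
    refine Finset.sum_nonpos fun i _ => ?_
    rw [real_inner_smul_right]
    exact mul_nonpos_of_nonneg_of_nonpos ((mem_closedInterior_iff_coord _ _).1 hmem i) (h i)
  have h3 : inner ℝ (nearest T w - y) (nearest T w - y) ≤ 0 := by
    have : inner ℝ (nearest T w - y) (nearest T w - y) =
        inner ℝ (w - y) (nearest T w - y) + inner ℝ (w - nearest T w) (y - nearest T w) := by
      rw [← neg_sub (nearest T w) y, inner_neg_right, ← sub_eq_add_neg, ← inner_sub_left]
      congr 1; abel
    linarith
  exact sub_eq_zero.1 (real_inner_self_nonpos.1 h3)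

theorem bary_nonneg (T : FullSimplex d) (i : Fin (d + 1)) (w : Space d) :
    0 ≤ bary T i (nearest T w) :=
  (mem_closedInterior_iff_coord _ _).1 (nearest_spec T w).1 i

theorem sum_bary (T : FullSimplex d) (x : Space d) : ∑ i, bary T i x = 1 :=
  sum_coord_eq_one _ _

theorem sum_bary_smul (T : FullSimplex d) (x : Space d) :
    ∑ i, bary T i x • (halfSimplex T).points i = x :=
  sum_coord_smul_points _ _

/-- The translate of a vertex of the minimal face of `U` containing `φ(w)` by `w - φ(w)` stays in
`T`. -/
theorem CompletelyWellCentered.translate_mem {T : FullSimplex d} (hT : CompletelyWellCentered T)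
    {w : Space d} (hw : w ∈ T.closedInterior) {i : Fin (d + 1)}
    (hi : bary T i (nearest T w) ≠ 0) :
    (halfSimplex T).points i + (w - nearest T w) ∈ T.closedInterior := by
  set y := nearest T w with hy
  set c := T.circumcenter with hc
  set β : Fin (d + 1) → ℝ := fun k => (vertexBasis T).coord k w
  have hβ : ∀ k, 0 ≤ β k := (mem_closedInterior_iff_coord _ _).1 hw
  have hβ1 : ∑ k, β k = 1 := sum_coord_eq_one T w
  have hβw : ∑ k, β k • T.points k = w := sum_coord_smul_points T w
  have hb1 := sum_bary T y
  have hby := sum_bary_smul T y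
  have hbv : (1 / 2 : ℝ) • (c + ∑ k, bary T k y • T.points k) = y := by
    conv_rhs => rw [← hby]
    simp only [halfSimplex_points, smul_comm _ (1 / 2 : ℝ), ← Finset.smul_sum, smul_add,
      Finset.sum_add_distrib, ← Finset.sum_smul, hb1, one_smul, hc]
  -- Since `∑ b_k v_k = 2y - c`, the point `c + 2(w - y)` equals `2w - ∑ b_k v_k`. Where `b_k = 0`
  -- its weight is `2 β_k ≥ 0`.
  have hx : ∑ k, (2 * β k - bary T k y) • T.points k = c + (2 : ℝ) • (w - y) := by
    simp only [sub_smul, mul_smul, Finset.sum_sub_distrib, ← Finset.smul_sum, hβw]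
    have hv : ∑ k, bary T k y • T.points k = (2 : ℝ) • y - c := by
      have h := congrArg (fun z => (2 : ℝ) • z - c) hbv
      rw [← h]
      module
    rw [hv]
    module
  have hpt : ∀ k, inner ℝ (w - y) ((halfSimplex T).points k - y) ≤ 0 := fun k =>
    inner_sub_nearest_nonpos T w ((halfSimplex T).point_mem_closedInterior k)
  have hsum : ∑ k, bary T k y * inner ℝ (w - y) ((halfSimplex T).points k - y) = 0 := by
    simp only [← real_inner_smul_right, ← inner_sum]
    simp only [smul_sub, Finset.sum_sub_distrib, ← Finset.sum_smul, hby, hb1, one_smul, sub_self,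
      inner_zero_right]
  -- Complementary slackness: nonpositive terms with sum zero all vanish.
  have heq : ∀ k, bary T k y ≠ 0 → inner ℝ (w - y) ((halfSimplex T).points k - y) = 0 := by
    intro k hk
    have := (Finset.sum_eq_zero_iff_of_nonpos fun k _ =>
      mul_nonpos_of_nonneg_of_nonpos (bary_nonneg T k w) (hpt k)).1 hsum k (Finset.mem_univ k)
    exact (mul_eq_zero.1 this).resolve_left hk
  have hmem := mem_convexHull_of_voronoi T.points c hT.exists_face_weights
    (Finset.univ.filter fun k => bary T k y ≠ 0) ⟨i, by simpa using hi⟩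
    (fun k => 2 * β k - bary T k y)
    (by rw [Finset.sum_sub_distrib, ← Finset.mul_sum, hβ1, hb1]; norm_num)
    (fun k hk => by
      have : bary T k y = 0 := by simpa using hk
      rw [this]
      linarith [hβ k])
    (fun j hj l => by
      have hj' : bary T j y ≠ 0 := by simpa using hj
      have h1 : c + (2 : ℝ) • (w - y) - c = (2 : ℝ) • (w - y) := by abel
      have h2 : T.points l - T.points j = (2 : ℝ) •
          (((halfSimplex T).points l - y) - ((halfSimplex T).points j - y)) := by
        simp only [halfSimplex_points]; module
      rw [hx, h1, h2, real_inner_smul_left, real_inner_smul_right, inner_sub_right, heq j hj']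
      linarith [hpt l])
  rw [hx, Affine.Simplex.convexHull_eq_closedInterior] at hmem
  have hfin : (halfSimplex T).points i + (w - y) =
      (1 / 2 : ℝ) • (c + (2 : ℝ) • (w - y)) + (1 / 2 : ℝ) • T.points i := by
    rw [halfSimplex_points]; module
  rw [hfin]
  exact convex_closedInterior T hmem (T.point_mem_closedInterior i) (by norm_num) (by norm_num)
    (by norm_num)

/-! ### Taylor remainders on segments -/

theorem IntervalW2.abs_derivWithin_sub_le {ρ : ℝ} (hρ : 0 < ρ) {g : ℝ → ℝ}
    (hg : IntervalW2 0 ρ g) {t : ℝ} (ht : t ∈ Icc 0 ρ) :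
    |derivWithin g (Icc 0 ρ) t - derivWithin g (Icc 0 ρ) 0| ≤ t := by
  obtain ⟨-, hac, hae⟩ := hg
  have hac' : AbsolutelyContinuousOnInterval (derivWithin g (Icc 0 ρ)) 0 t :=
    hac.mono (by
      rw [uIcc_of_le ht.1, uIcc_of_le hρ.le]
      exact Icc_subset_Icc_right ht.2)
  rw [← hac'.integral_deriv_eq_sub, ← Real.norm_eq_abs]
  have h := intervalIntegral.norm_integral_le_of_norm_le_const_ae (a := 0) (b := t) (C := 1)
    (f := deriv (derivWithin g (Icc 0 ρ))) (by
      filter_upwards [hae] with s hs hs'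
      rw [uIoc_of_le ht.1] at hs'
      exact hs ⟨hs'.1.le, hs'.2.trans ht.2⟩)
  rwa [sub_zero, one_mul, abs_of_nonneg ht.1] at h

/-- The remainder vanishes at `0` and its derivative is at most `t` in modulus, so comparison with
`t² / 2` suffices. -/
theorem IntervalW2.abs_taylor_le {ρ : ℝ} (hρ : 0 < ρ) {g : ℝ → ℝ} (hg : IntervalW2 0 ρ g) :
    |g ρ - g 0 - derivWithin g (Icc 0 ρ) 0 * ρ| ≤ ρ ^ 2 / 2 := by
  set G := derivWithin g (Icc 0 ρ) with hG
  have hd : ∀ t ∈ Icc 0 ρ, HasDerivWithinAt (fun t => g t - g 0 - G 0 * t) (G t - G 0)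
      (Icc 0 ρ) t := fun t ht => by
    have h1 := (hg.1 t ht).hasDerivWithinAt
    have h2 := (h1.sub_const (g 0)).sub ((hasDerivWithinAt_id t (Icc 0 ρ)).const_mul (G 0))
    rw [mul_one] at h2
    exact h2
  have key := image_norm_le_of_norm_deriv_right_le_deriv_boundary
    (f := fun t => g t - g 0 - G 0 * t) (f' := fun t => G t - G 0) (a := 0) (b := ρ)
    (B := fun t => t ^ 2 / 2) (B' := fun t => t)
    (fun t ht => (hd t ht).continuousWithinAt)
    (fun t ht => (hd t (Ico_subset_Icc_self ht)).mono_of_mem_nhdsWithin (Icc_mem_nhdsGE_of_mem ht))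
    (by simp)
    (fun t => by
      have := ((hasDerivAt_id t).pow 2).div_const 2
      simpa using this)
    (fun t ht => hg.abs_derivWithin_sub_le hρ (Ico_subset_Icc_self ht))
  exact key (right_mem_Icc.2 hρ.le)

/-- Taylor's formula of first order for functions in `W²(P)`, `P` convex. -/
theorem abs_taylor_le_of_mem_W2 {P : Set (Space d)} (hP : Convex ℝ P) {f : Space d → ℝ}
    (hf : f ∈ W2 P) {x y : Space d} (hx : x ∈ P) (hy : y ∈ P) :
    |f y - f x - inner ℝ (gradientWithin f P x) (y - x)| ≤ ‖y - x‖ ^ 2 / 2 := by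
  by_cases hxy : x = y
  · simp [hxy]
  have hρ : 0 < ‖y - x‖ := norm_pos_iff.2 (sub_ne_zero.2 (Ne.symm hxy))
  have hW := hf.2 x hx y hy hxy
  have ht := hW.abs_taylor_le hρ
  set ρ := ‖y - x‖ with hρd
  have hγ : HasDerivWithinAt (fun t : ℝ => x + (t / ρ) • (y - x)) ((1 / ρ) • (y - x))
      (Icc 0 ρ) 0 := by
    have h1 := ((hasDerivWithinAt_id (0 : ℝ) (Icc 0 ρ)).div_const ρ).smul_const (y - x)
    exact h1.const_add x
  have hmaps : MapsTo (fun t : ℝ => x + (t / ρ) • (y - x)) (Icc 0 ρ) P := fun t ht =>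
    hP.add_smul_sub_mem hx hy ⟨div_nonneg ht.1 hρ.le, (div_le_one hρ).2 ht.2⟩
  have hdiff : DifferentiableWithinAt ℝ f P x :=
    (ContDiffOn.differentiableOn hf.1 one_ne_zero) x hx
  have hfd := hdiff.hasGradientWithinAt.hasFDerivWithinAt
  have hx0 : x = x + ((0 : ℝ) / ρ) • (y - x) := by simp
  have hcomp := HasFDerivWithinAt.comp_hasDerivWithinAt_of_eq (0 : ℝ) hfd hγ hmaps hx0
  have hder := hcomp.derivWithin (uniqueDiffOn_Icc hρ 0 (left_mem_Icc.2 hρ.le))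
  have hder' : derivWithin (fun t : ℝ => f (x + (t / ρ) • (y - x))) (Icc 0 ρ) 0 =
      1 / ρ * inner ℝ (gradientWithin f P x) (y - x) := by
    rw [← real_inner_smul_right]
    exact hder
  rw [hder'] at ht
  have h1 : x + (ρ / ρ) • (y - x) = y := by rw [div_self hρ.ne', one_smul]; abel
  have h2 : 1 / ρ * inner ℝ (gradientWithin f P x) (y - x) * ρ =
      inner ℝ (gradientWithin f P x) (y - x) := by field_simp
  simpa only [h1, ← hx0, h2] using ht

/-! ### The upper bound -/

/-- The error of the recovery method on `W²(T)` is at most `𝓔`. -/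
theorem CompletelyWellCentered.abs_sub_recovery_le {T : FullSimplex d}
    (hT : CompletelyWellCentered T) {f : Space d → ℝ} (hf : f ∈ W2 T.closedInterior) {w : Space d}
    (hw : w ∈ T.closedInterior) :
    |f w - recovery T (info T T.closedInterior f) w| ≤ errorFun T w := by
  set P := T.closedInterior with hPdef
  have hP : Convex ℝ P := convex_closedInterior T
  set y := nearest T w with hy
  set u := (halfSimplex T).points with hu
  set c := T.circumcenter with hc
  set b : Fin (d + 1) → ℝ := fun i => bary T i y
  have hb1 : ∑ i, b i = 1 := sum_bary T y
  have hby : ∑ i, b i • u i = y := sum_bary_smul T y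
  have hb0 : ∀ i, 0 ≤ b i := fun i => bary_nonneg T i w
  set A : Fin (d + 1) → ℝ := fun i =>
    f (u i + (w - y)) - f (T.points i) -
      inner ℝ (gradientWithin f P (T.points i)) (u i + (w - y) - T.points i)
  set B : Fin (d + 1) → ℝ := fun i =>
    f (u i + (w - y)) - f w - inner ℝ (gradientWithin f P w) (u i + (w - y) - w)
  have hlin : ∑ i, b i * inner ℝ (gradientWithin f P w) (u i + (w - y) - w) = 0 := by
    simp only [← real_inner_smul_right, ← inner_sum]
    have : ∑ i, b i • (u i + (w - y) - w) = 0 := by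
      have h : ∀ i, u i + (w - y) - w = u i - y := fun i => by abel
      simp only [h, smul_sub, Finset.sum_sub_distrib, ← Finset.sum_smul, hby, hb1, one_smul,
        sub_self]
    rw [this, inner_zero_right]
  have hrep : f w - recovery T (info T P f) w = ∑ i, b i * (A i - B i) := by
    have h1 : ∀ i, b i * (A i - B i) = b i * f w
        - b i * (f (T.points i) + inner ℝ (gradientWithin f P (T.points i))
            (w - y + (1 / 2 : ℝ) • (c - T.points i)))
        + b i * inner ℝ (gradientWithin f P w) (u i + (w - y) - w) := fun i => by
      have : w - y + (1 / 2 : ℝ) • (c - T.points i) = u i + (w - y) - T.points i := by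
        rw [hu, halfSimplex_points]; module
      rw [this]
      simp only [A, B]
      ring
    simp only [h1, Finset.sum_add_distrib, Finset.sum_sub_distrib, ← Finset.sum_mul, hb1, one_mul,
      hlin, add_zero]
    rfl
  have hAB : ∀ i, |b i * (A i - B i)| ≤
      b i * ((‖u i + (w - y) - T.points i‖ ^ 2 + ‖u i + (w - y) - w‖ ^ 2) / 2) := fun i => by
    rw [abs_mul, abs_of_nonneg (hb0 i)]
    by_cases hi : b i = 0
    -- When `b i = 0` the translated vertex may leave `T`, but its term carries no weight.
    · simp [hi]
    · refine mul_le_mul_of_nonneg_left ?_ (hb0 i)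
      have hmem : u i + (w - y) ∈ P := hT.translate_mem hw hi
      have hA : |A i| ≤ _ := abs_taylor_le_of_mem_W2 hP hf (T.point_mem_closedInterior i) hmem
      have hB : |B i| ≤ _ := abs_taylor_le_of_mem_W2 hP hf hw hmem
      have := abs_sub (A i) (B i)
      linarith
  have hid : ∑ i, b i * ((‖u i + (w - y) - T.points i‖ ^ 2 + ‖u i + (w - y) - w‖ ^ 2) / 2) =
      errorFun T w := by
    -- Each bracket differs from `𝓔(w)` only by a term linear in `u_i - y`, and such terms average
    -- to zero.
    have hterm : ∀ i, b i * ((‖u i + (w - y) - T.points i‖ ^ 2 + ‖u i + (w - y) - w‖ ^ 2) / 2) =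
        b i * errorFun T w - b i * inner ℝ ((w - y) + (y - c)) (u i - y) := fun i => by
      rw [← mul_sub]
      congr 1
      have hR : inner ℝ (u i - c) (u i - c) = T.circumradius ^ 2 / 4 := by
        have : u i - c = (1 / 2 : ℝ) • (T.points i - c) := by
          rw [hu, halfSimplex_points]; module
        rw [this, real_inner_smul_left, real_inner_smul_right, real_inner_self_eq_norm_sq,
          norm_points_sub_circumcenter]
        ring
      have e1 : u i + (w - y) - T.points i = (w - y) - (u i - c) := by
        rw [hu, halfSimplex_points]; module
      have e2 : u i + (w - y) - w = (u i - c) - (y - c) := by abel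
      have e3 : w - c = (w - y) + (y - c) := by abel
      have e4 : u i - y = (u i - c) - (y - c) := by abel
      rw [errorFun, ← hy, ← hc, e1, e2, e3, e4, ← hR]
      simp only [← real_inner_self_eq_norm_sq]
      generalize w - y = n
      generalize u i - c = q
      generalize y - c = z
      simp only [inner_add_left, inner_add_right, inner_sub_left, inner_sub_right,
        real_inner_comm n q, real_inner_comm n z, real_inner_comm q z]
      rw [real_inner_comm q n, real_inner_comm z n, real_inner_comm z q]
      ring
    have hzero : ∑ i, b i * inner ℝ ((w - y) + (y - c)) (u i - y) = 0 := by
      simp only [← real_inner_smul_right, ← inner_sum]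
      simp only [smul_sub, Finset.sum_sub_distrib, ← Finset.sum_smul, hby, hb1, one_smul,
        sub_self, inner_zero_right]
    simp only [hterm, Finset.sum_sub_distrib, hzero, sub_zero, ← Finset.sum_mul, hb1, one_mul]
  rw [hrep, ← hid]
  exact (Finset.abs_sum_le_sum_abs _ _).trans (Finset.sum_le_sum fun i _ => hAB i)

/-! ### Regularity of the projection and of the error function -/

/-- The metric projection is firmly nonexpansive. -/
theorem norm_sq_nearest_sub_le_inner (T : FullSimplex d) (x z : Space d) :
    ‖nearest T x - nearest T z‖ ^ 2 ≤ inner ℝ (nearest T x - nearest T z) (x - z) := by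
  have h1 := inner_sub_nearest_nonpos T x (nearest_spec T z).1
  have h2 := inner_sub_nearest_nonpos T z (nearest_spec T x).1
  have h3 : inner ℝ (nearest T x - nearest T z) (x - z) -
      inner ℝ (nearest T x - nearest T z) (nearest T x - nearest T z) =
      -(inner ℝ (x - nearest T x) (nearest T z - nearest T x) +
        inner ℝ (z - nearest T z) (nearest T x - nearest T z)) := by
    rw [← neg_sub (nearest T x) (nearest T z), inner_neg_right, ← inner_sub_right, neg_add,
      neg_neg, ← sub_eq_add_neg, ← inner_sub_left, real_inner_comm]
    congr 1
    abel
  rw [← real_inner_self_eq_norm_sq]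
  linarith

theorem norm_nearest_sub_le (T : FullSimplex d) (x z : Space d) :
    ‖nearest T x - nearest T z‖ ≤ ‖x - z‖ := by
  have h1 := norm_sq_nearest_sub_le_inner T x z
  have h2 := real_inner_le_norm (nearest T x - nearest T z) (x - z)
  by_contra! h
  nlinarith [norm_nonneg (x - z)]

theorem continuous_nearest (T : FullSimplex d) : Continuous (nearest T) := by
  refine (LipschitzWith.of_dist_le_mul (K := 1) fun x z => ?_).continuous
  simpa [dist_eq_norm] using norm_nearest_sub_le T x z

theorem continuous_errorFun (T : FullSimplex d) : Continuous (errorFun T) := by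
  have := continuous_nearest T
  unfold errorFun
  fun_prop

theorem continuous_recovery (T : FullSimplex d) (y : Data d) : Continuous (recovery T y) := by
  have := continuous_nearest T
  have hb : ∀ i, Continuous (fun w => bary T i (nearest T w)) := fun i =>
    ((vertexBasis (halfSimplex T)).coord i).continuous_of_finiteDimensional.comp this
  unfold recovery
  fun_prop

/-- Shows that the squared distance to `U` has gradient `2(w - φ(w))`. Each projection is a
competitor for the other point; the lower bound also uses that `id - φ` is monotone, since `φ` is
nonexpansive. -/
theorem abs_sqNorm_sub_nearest_sub_le (T : FullSimplex d) (w z : Space d) :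
    |‖z - nearest T z‖ ^ 2 - ‖w - nearest T w‖ ^ 2 -
      2 * inner ℝ (w - nearest T w) (z - w)| ≤ ‖z - w‖ ^ 2 := by
  have h1 : ‖z - nearest T z‖ ^ 2 ≤ ‖z - nearest T w‖ ^ 2 := by
    have := (nearest_spec T z).2 _ (nearest_spec T w).1
    simp only [dist_eq_norm] at this
    gcongr
  have h2 : ‖w - nearest T w‖ ^ 2 ≤ ‖w - nearest T z‖ ^ 2 := by
    have := (nearest_spec T w).2 _ (nearest_spec T z).1
    simp only [dist_eq_norm] at this
    gcongr
  have h3 : ‖z - nearest T w‖ ^ 2 =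
      ‖w - nearest T w‖ ^ 2 + 2 * inner ℝ (w - nearest T w) (z - w) + ‖z - w‖ ^ 2 := by
    rw [← norm_add_sq_real]; congr 2; abel
  have h4 : ‖w - nearest T z‖ ^ 2 =
      ‖z - nearest T z‖ ^ 2 - 2 * inner ℝ (z - nearest T z) (z - w) + ‖z - w‖ ^ 2 := by
    rw [← norm_sub_sq_real]; congr 2; abel
  have h5 : 0 ≤ inner ℝ (z - nearest T z) (z - w) - inner ℝ (w - nearest T w) (z - w) := by
    have hs := real_inner_le_norm (nearest T z - nearest T w) (z - w)
    have hn := norm_nearest_sub_le T z w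
    have : inner ℝ (z - nearest T z) (z - w) - inner ℝ (w - nearest T w) (z - w) =
        inner ℝ (z - w) (z - w) - inner ℝ (nearest T z - nearest T w) (z - w) := by
      rw [← inner_sub_left, ← inner_sub_left]; congr 1; abel
    rw [this, real_inner_self_eq_norm_sq]
    nlinarith [norm_nonneg (z - w)]
  rw [abs_le]
  constructor <;> linarith

theorem hasGradientAt_errorFun (T : FullSimplex d) (w : Space d) :
    HasGradientAt (errorFun T) (w - (2 : ℝ) • nearest T w + T.circumcenter) w := by
  rw [hasGradientAt_iff_isLittleO]
  refine Asymptotics.IsBigO.trans_isLittleO (g := fun z => ‖z - w‖ ^ 2) ?_ ?_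
  · refine Asymptotics.IsBigO.of_bound 2 (Filter.Eventually.of_forall fun z => ?_)
    have h1 := abs_sqNorm_sub_nearest_sub_le T w z
    have h2 : ‖z - T.circumcenter‖ ^ 2 = ‖w - T.circumcenter‖ ^ 2 +
        2 * inner ℝ (w - T.circumcenter) (z - w) + ‖z - w‖ ^ 2 := by
      rw [← norm_add_sq_real]; congr 2; abel
    have h3 : inner ℝ (w - (2 : ℝ) • nearest T w + T.circumcenter) (z - w) =
        2 * inner ℝ (w - nearest T w) (z - w) - inner ℝ (w - T.circumcenter) (z - w) := by
      rw [← real_inner_smul_left, ← inner_sub_left]; congr 1; module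
    rw [h3, Real.norm_eq_abs, Real.norm_eq_abs, abs_of_nonneg (sq_nonneg ‖z - w‖)]
    simp only [errorFun, h2]
    rw [abs_le] at h1 ⊢
    constructor <;> linarith [sq_nonneg ‖z - w‖]
  · have := Asymptotics.isLittleO_norm_pow_id (E' := Space d) one_lt_two
    have h2 : Filter.Tendsto (fun z : Space d => z - w) (nhds w) (nhds 0) := by
      have : Continuous fun z : Space d => z - w := by fun_prop
      simpa using this.tendsto w
    exact this.comp_tendsto h2

/-- Firm nonexpansiveness of `φ` is what makes the reflection `2φ - id` nonexpansive. -/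
theorem norm_gradient_errorFun_sub_le (T : FullSimplex d) (x z : Space d) :
    ‖(x - (2 : ℝ) • nearest T x + T.circumcenter) -
      (z - (2 : ℝ) • nearest T z + T.circumcenter)‖ ≤ ‖x - z‖ := by
  have h1 := norm_sq_nearest_sub_le_inner T x z
  have h2 : (x - (2 : ℝ) • nearest T x + T.circumcenter) -
      (z - (2 : ℝ) • nearest T z + T.circumcenter) =
      (x - z) - (2 : ℝ) • (nearest T x - nearest T z) := by module
  have h3 : ‖(x - z) - (2 : ℝ) • (nearest T x - nearest T z)‖ ^ 2 ≤ ‖x - z‖ ^ 2 := by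
    rw [norm_sub_sq_real, real_inner_smul_right, norm_smul, mul_pow, Real.norm_two,
      real_inner_comm]
    linarith
  rw [h2]
  exact (sq_le_sq₀ (norm_nonneg _) (norm_nonneg _)).1 h3

/-- A function with a `1`-Lipschitz gradient is in `W²`. -/
theorem mem_W2_of_lipschitz_gradient (P : Set (Space d)) {f : Space d → ℝ}
    {f' : Space d → Space d} (hf : ∀ x, HasGradientAt f (f' x) x)
    (hlip : ∀ x z, ‖f' x - f' z‖ ≤ ‖x - z‖) : f ∈ W2 P := by
  have hcont : Continuous f' := by
    refine (LipschitzWith.of_dist_le_mul (K := 1) fun x z => ?_).continuous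
    simpa [dist_eq_norm] using hlip x z
  refine ⟨ContDiff.contDiffOn (contDiff_one_iff_hasFDerivAt.2
    ⟨fun x => InnerProductSpace.toDual ℝ (Space d) (f' x), by fun_prop,
      fun x => (hf x).hasFDerivAt⟩), fun x _ y _ hxy => ?_⟩
  have hρ : 0 < ‖y - x‖ := norm_pos_iff.2 (sub_ne_zero.2 (Ne.symm hxy))
  set ρ := ‖y - x‖ with hρd
  set G : ℝ → ℝ := fun t => inner ℝ (f' (x + (t / ρ) • (y - x))) ((1 / ρ) • (y - x))
  have hder : ∀ t, HasDerivAt (fun t : ℝ => f (x + (t / ρ) • (y - x))) (G t) t := fun t => by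
    have hγ : HasDerivAt (fun t : ℝ => x + (t / ρ) • (y - x)) ((1 / ρ) • (y - x)) t :=
      (((hasDerivAt_id t).div_const ρ).smul_const (y - x)).const_add x
    exact (hf _).hasFDerivAt.comp_hasDerivAt t hγ
  have hdw : ∀ t ∈ Icc 0 ρ,
      derivWithin (fun t : ℝ => f (x + (t / ρ) • (y - x))) (Icc 0 ρ) t = G t := fun t ht =>
    (hder t).hasDerivWithinAt.derivWithin (uniqueDiffOn_Icc hρ t ht)
  have hG : LipschitzWith 1 G := LipschitzWith.of_dist_le_mul fun s t => by
    have hunit : ‖(1 / ρ) • (y - x)‖ = 1 := by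
      rw [norm_smul, ← hρd, Real.norm_of_nonneg (by positivity), one_div_mul_cancel hρ.ne']
    rw [NNReal.coe_one, one_mul, Real.dist_eq, ← inner_sub_left]
    refine (abs_real_inner_le_norm _ _).trans ?_
    rw [hunit, mul_one]
    refine (hlip _ _).trans ?_
    have : x + (s / ρ) • (y - x) - (x + (t / ρ) • (y - x)) = (s - t) • (1 / ρ) • (y - x) := by
      module
    rw [this, norm_smul, hunit, mul_one, Real.dist_eq, Real.norm_eq_abs]
  refine ⟨fun t _ => (hder t).differentiableAt.differentiableWithinAt, ?_, ?_⟩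
  · refine LipschitzOnWith.absolutelyContinuousOnInterval (K := 1) ?_
    rw [uIcc_of_le hρ.le]
    intro s hs t ht
    rw [hdw s hs, hdw t ht]
    exact hG s t
  -- The one-sided derivative agrees with `G` only on `[0, ρ]`; away from the two end points it does
  -- so on a neighborhood, as `deriv` requires.
  · have hends : ∀ᵐ t ∂(volume : Measure ℝ), t ≠ 0 ∧ t ≠ ρ :=
      (Measure.ae_ne volume 0).and (Measure.ae_ne volume ρ)
    filter_upwards [hends] with t ht htI
    have hmem : t ∈ Ioo 0 ρ := ⟨lt_of_le_of_ne htI.1 ht.1.symm, lt_of_le_of_ne htI.2 ht.2⟩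
    have heq : derivWithin (fun t : ℝ => f (x + (t / ρ) • (y - x))) (Icc 0 ρ) =ᶠ[nhds t] G := by
      filter_upwards [isOpen_Ioo.mem_nhds hmem] with s hs using hdw s (Ioo_subset_Icc_self hs)
    rw [heq.deriv_eq]
    simpa using norm_deriv_le_of_lipschitz (x₀ := t) hG

theorem errorFun_mem_W2 (T : FullSimplex d) (P : Set (Space d)) : errorFun T ∈ W2 P :=
  mem_W2_of_lipschitz_gradient P (hasGradientAt_errorFun T) (norm_gradient_errorFun_sub_le T)

theorem hasGradientAt_neg {f : Space d → ℝ} {g x : Space d} (h : HasGradientAt f g x) :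
    HasGradientAt (-f) (-g) x := by
  rw [hasGradientAt_iff_hasFDerivAt, map_neg]
  exact h.hasFDerivAt.neg

theorem neg_errorFun_mem_W2 (T : FullSimplex d) (P : Set (Space d)) : -errorFun T ∈ W2 P :=
  mem_W2_of_lipschitz_gradient P (fun x => hasGradientAt_neg (hasGradientAt_errorFun T x)) fun x z => by
    rw [neg_sub_neg, norm_sub_rev]
    exact norm_gradient_errorFun_sub_le T x z

/-! ### Vanishing data of the error function -/

/-- All vertices of `U` lie on the sphere of radius `R/2` about `c`, and `v_i - u_i` is the outward
radial vector at `u_i`; Cauchy–Schwarz gives the variational inequality. -/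
theorem nearest_points (T : FullSimplex d) (i : Fin (d + 1)) :
    nearest T (T.points i) = (halfSimplex T).points i := by
  refine nearest_eq_of_inner_nonpos T ((halfSimplex T).point_mem_closedInterior i) fun j => ?_
  have h1 : T.points i - (halfSimplex T).points i =
      (1 / 2 : ℝ) • (T.points i - T.circumcenter) := by
    rw [halfSimplex_points]; module
  have h2 : (halfSimplex T).points j - (halfSimplex T).points i =
      (1 / 2 : ℝ) • ((T.points j - T.circumcenter) - (T.points i - T.circumcenter)) := by
    simp only [halfSimplex_points]; module
  rw [h1, h2, real_inner_smul_left, real_inner_smul_right, inner_sub_right,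
    real_inner_self_eq_norm_sq]
  have h3 := real_inner_le_norm (T.points i - T.circumcenter) (T.points j - T.circumcenter)
  rw [norm_points_sub_circumcenter, norm_points_sub_circumcenter] at h3
  rw [norm_points_sub_circumcenter]
  nlinarith

theorem errorFun_points (T : FullSimplex d) (i : Fin (d + 1)) : errorFun T (T.points i) = 0 := by
  have h1 : T.points i - (halfSimplex T).points i =
      (1 / 2 : ℝ) • (T.points i - T.circumcenter) := by
    rw [halfSimplex_points]; module
  rw [errorFun, nearest_points, h1, norm_smul, norm_points_sub_circumcenter, mul_pow,
    Real.norm_of_nonneg (by norm_num)]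
  ring

theorem uniqueDiffOn_closedInterior (T : FullSimplex d) : UniqueDiffOn ℝ T.closedInterior := by
  refine uniqueDiffOn_convex (convex_closedInterior T) ?_
  rw [← Affine.Simplex.convexHull_eq_closedInterior]
  exact interior_convexHull_nonempty_iff_affineSpan_eq_top.2 (T.span_eq_top (by simp))

/-- The simplex is convex with nonempty interior, so the gradient relative to it is unique even at a
vertex. -/
theorem info_eq_zero {T : FullSimplex d} {f : Space d → ℝ} (h0 : ∀ i, f (T.points i) = 0)
    (h1 : ∀ i, HasGradientAt f 0 (T.points i)) : info T T.closedInterior f = 0 := by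
  refine Prod.ext (funext h0) (funext fun i => ?_)
  have h := (h1 i).hasFDerivAt.hasFDerivWithinAt (s := T.closedInterior)
  change gradientWithin f T.closedInterior (T.points i) = 0
  rw [gradientWithin, h.fderivWithin (uniqueDiffOn_closedInterior T _ (T.point_mem_closedInterior i)),
    map_zero, map_zero]

theorem hasGradientAt_errorFun_points (T : FullSimplex d) (i : Fin (d + 1)) :
    HasGradientAt (errorFun T) 0 (T.points i) := by
  have h := hasGradientAt_errorFun T (T.points i)
  have h0 : T.points i - (2 : ℝ) • nearest T (T.points i) + T.circumcenter = 0 := by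
    rw [nearest_points, halfSimplex_points]; module
  rwa [h0] at h

theorem info_errorFun (T : FullSimplex d) : info T T.closedInterior (errorFun T) = 0 :=
  info_eq_zero (errorFun_points T) (hasGradientAt_errorFun_points T)

theorem info_neg_errorFun (T : FullSimplex d) : info T T.closedInterior (-errorFun T) = 0 :=
  info_eq_zero (fun i => by simp [errorFun_points T i]) fun i => by
    simpa using hasGradientAt_neg (hasGradientAt_errorFun_points T i)

/-! ### Optimality at a point -/

/-- No algorithm has a smaller error at `w` than `𝓔(w)`: the functions `±𝓔` share the data `0`. -/
theorem errorFun_le_pointError (T : FullSimplex d) (w : Space d) (Ψ : Data d → ℝ) :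
    ((errorFun T w : ℝ) : EReal) ≤
      pointError T T.closedInterior (W2 T.closedInterior) w Ψ := by
  have h1 : ((|errorFun T w - Ψ 0| : ℝ) : EReal) ≤
      pointError T T.closedInterior (W2 T.closedInterior) w Ψ := by
    have := le_iSup₂ (f := fun f (_ : f ∈ W2 T.closedInterior) =>
      ((|f w - Ψ (info T T.closedInterior f)| : ℝ) : EReal)) _ (errorFun_mem_W2 T _)
    rwa [info_errorFun] at this
  have h2 : ((|-errorFun T w - Ψ 0| : ℝ) : EReal) ≤
      pointError T T.closedInterior (W2 T.closedInterior) w Ψ := by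
    have := le_iSup₂ (f := fun f (_ : f ∈ W2 T.closedInterior) =>
      ((|f w - Ψ (info T T.closedInterior f)| : ℝ) : EReal)) _ (neg_errorFun_mem_W2 T _)
    rwa [info_neg_errorFun] at this
  by_cases h : 0 ≤ Ψ 0
  · refine le_trans (EReal.coe_le_coe_iff.2 ?_) h2
    have := neg_abs_le (-errorFun T w - Ψ 0)
    linarith
  · refine le_trans (EReal.coe_le_coe_iff.2 ?_) h1
    have := le_abs_self (errorFun T w - Ψ 0)
    linarith

theorem CompletelyWellCentered.pointError_recovery_le {T : FullSimplex d}
    (hT : CompletelyWellCentered T) {w : Space d} (hw : w ∈ T.closedInterior) :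
    pointError T T.closedInterior (W2 T.closedInterior) w (fun y => recovery T y w) ≤
      ((errorFun T w : ℝ) : EReal) :=
  iSup₂_le fun _ hf => EReal.coe_le_coe_iff.2 (hT.abs_sub_recovery_le hf hw)

theorem CompletelyWellCentered.optimalPointError_eq {T : FullSimplex d}
    (hT : CompletelyWellCentered T) {w : Space d} (hw : w ∈ T.closedInterior) :
    optimalPointError T T.closedInterior (W2 T.closedInterior) w = ((errorFun T w : ℝ) : EReal) :=
  le_antisymm ((iInf_le _ _).trans (hT.pointError_recovery_le hw))
    (le_iInf fun Ψ => errorFun_le_pointError T w Ψ)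

theorem CompletelyWellCentered.isOptimalAt_recovery {T : FullSimplex d}
    (hT : CompletelyWellCentered T) {w : Space d} (hw : w ∈ T.closedInterior) :
    IsOptimalAt T T.closedInterior (W2 T.closedInterior) w (fun y => recovery T y w) := by
  rw [IsOptimalAt, hT.optimalPointError_eq hw]
  exact le_antisymm (hT.pointError_recovery_le hw) (errorFun_le_pointError T w _)

/-! ### Optimality in monotone seminorms -/

/-- The error function as an element of `C(T)`. -/
def errorC (T : FullSimplex d) : C(T.closedInterior, ℝ) :=
  ⟨fun w => errorFun T w, (continuous_errorFun T).comp continuous_subtype_val⟩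

/-- The recovery method as a map into `C(T)`. -/
def recoveryC (T : FullSimplex d) (y : Data d) : C(T.closedInterior, ℝ) :=
  ⟨fun w => recovery T y w, (continuous_recovery T y).comp continuous_subtype_val⟩

/-- No global algorithm has a smaller error than `‖𝓔‖`. -/
theorem seminorm_errorC_le_globalError (T : FullSimplex d)
    (N : Seminorm ℝ C(T.closedInterior, ℝ)) (Φ : Data d → C(T.closedInterior, ℝ)) :
    ((N (errorC T) : ℝ) : EReal) ≤ globalError T (W2_subset_C1 T.closedInterior) N Φ := by
  have h1 : ((N (errorC T - Φ 0) : ℝ) : EReal) ≤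
      globalError T (W2_subset_C1 T.closedInterior) N Φ := by
    rw [← info_errorFun T]
    exact le_iSup (fun f : W2 T.closedInterior =>
      ((N (restrictC (W2_subset_C1 T.closedInterior f.2) -
        Φ (info T T.closedInterior f)) : ℝ) : EReal)) ⟨_, errorFun_mem_W2 T _⟩
  have h2 : ((N (-errorC T - Φ 0) : ℝ) : EReal) ≤
      globalError T (W2_subset_C1 T.closedInterior) N Φ := by
    rw [← info_neg_errorFun T]
    exact le_iSup (fun f : W2 T.closedInterior =>
      ((N (restrictC (W2_subset_C1 T.closedInterior f.2) -
        Φ (info T T.closedInterior f)) : ℝ) : EReal)) ⟨_, neg_errorFun_mem_W2 T _⟩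
  -- By the triangle inequality one of the errors for `±𝓔` is at least `‖𝓔‖`; monotonicity is needed
  -- only for the upper bound.
  have h3 : N ((2 : ℝ) • errorC T) ≤ N (errorC T - Φ 0) + N (-errorC T - Φ 0) := by
    have : (2 : ℝ) • errorC T = (errorC T - Φ 0) - (-errorC T - Φ 0) := by module
    rw [this]
    exact map_sub_le_add N _ _
  rw [map_smul_eq_mul, Real.norm_two] at h3
  by_cases h : N (errorC T) ≤ N (errorC T - Φ 0)
  · exact (EReal.coe_le_coe_iff.2 h).trans h1
  · exact (EReal.coe_le_coe_iff.2 (by linarith)).trans h2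

theorem CompletelyWellCentered.globalError_recoveryC_le {T : FullSimplex d}
    (hT : CompletelyWellCentered T) {N : Seminorm ℝ C(T.closedInterior, ℝ)} (hN : IsMonotone N) :
    globalError T (W2_subset_C1 T.closedInterior) N (recoveryC T) ≤
      ((N (errorC T) : ℝ) : EReal) :=
  iSup_le fun f => EReal.coe_le_coe_iff.2 (hN _ _ fun w =>
    (hT.abs_sub_recovery_le f.2 w.2).trans (le_abs_self _))

theorem CompletelyWellCentered.optimalGlobalError_eq {T : FullSimplex d}
    (hT : CompletelyWellCentered T) {N : Seminorm ℝ C(T.closedInterior, ℝ)} (hN : IsMonotone N) :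
    optimalGlobalError T (W2_subset_C1 T.closedInterior) N = ((N (errorC T) : ℝ) : EReal) :=
  le_antisymm ((iInf_le _ _).trans (hT.globalError_recoveryC_le hN))
    (le_iInf fun Φ => seminorm_errorC_le_globalError T N Φ)

theorem CompletelyWellCentered.isGloballyOptimal_recoveryC {T : FullSimplex d}
    (hT : CompletelyWellCentered T) {N : Seminorm ℝ C(T.closedInterior, ℝ)} (hN : IsMonotone N) :
    IsGloballyOptimal T (W2_subset_C1 T.closedInterior) N (recoveryC T) := by
  rw [IsGloballyOptimal, hT.optimalGlobalError_eq hN]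
  exact le_antisymm (hT.globalError_recoveryC_le hN) (seminorm_errorC_le_globalError T N _)

end SimplexRecovery

end

theorem corollary4p2 (d : ℕ) (T : SimplexRecovery.FullSimplex d)
    (hT : SimplexRecovery.CompletelyWellCentered T) :
    (∀ w ∈ T.closedInterior,
      SimplexRecovery.IsOptimalAt T T.closedInterior (SimplexRecovery.W2 T.closedInterior) w
        (fun y => SimplexRecovery.recovery T y w) ∧
      SimplexRecovery.optimalPointError T T.closedInterior
        (SimplexRecovery.W2 T.closedInterior) w = ((SimplexRecovery.errorFun T w : ℝ) : EReal)) ∧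
    ∃ (Φ : SimplexRecovery.Data d → C(T.closedInterior, ℝ)) (E : C(T.closedInterior, ℝ)),
      (∀ y w, Φ y w = SimplexRecovery.recovery T y w) ∧
      (∀ w, E w = SimplexRecovery.errorFun T w) ∧
      SimplexRecovery.IsPointwiseOptimal T (SimplexRecovery.W2 T.closedInterior) Φ ∧
      ∀ N : Seminorm ℝ C(T.closedInterior, ℝ), SimplexRecovery.IsMonotone N →
        SimplexRecovery.IsGloballyOptimal T
          (SimplexRecovery.W2_subset_C1 T.closedInterior) N Φ ∧
        SimplexRecovery.optimalGlobalError T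
          (SimplexRecovery.W2_subset_C1 T.closedInterior) N = ((N E : ℝ) : EReal) :=
  ⟨fun _ hw => ⟨hT.isOptimalAt_recovery hw, hT.optimalPointError_eq hw⟩,
    SimplexRecovery.recoveryC T, SimplexRecovery.errorC T, fun _ _ => rfl, fun _ => rfl,
    fun w => hT.isOptimalAt_recovery w.2,
    fun _ hN => ⟨hT.isGloballyOptimal_recoveryC hN, hT.optimalGlobalError_eq hN⟩⟩
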